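/- Let $T\subset\mathbb{R}^n$ be a convex body (a compact convex set with non-empty interior). A supporting hyperplane of $T$ is a hyperplane that meets $T$ and has $T$ on one closed side. A closed billiard trajectory in $T$ is a closed polygonal line with pairwise distinct vertices $p_1,\dots,p_m\in\partial T$ in this order, $m\ge 2$ (indices modulo $m$), such that for every $j$ the point $p_j$ does not lie on the segment from $p_{j-1}$ to $p_{j+1}$ and there is a supporting hyperplane $H_j$ of $T$ through $p_j$ such that $p_j$ minimizes $\|q-p_{j-1}\|+\|p_{j+1}-q\|$ over all $q\in H_j$. Its length is $\sum_{j=1}^m\|p_{j+1}-p_j\|$, and it is length-minimizing if no closed billiard trajectory in $T$, with any number of vertices, is shorter. Let $p=(p_1,\dots,p_m)$ be a length-minimizing closed billiard trajectory in $T$, and let $V\subset\mathbb{R}^n$ be the affine subspace cutting out the smallest affine section of $T$ containing $p$, that is, $T\cap V$ contains $p_1,\dots,p_m$ and is contained in every section $T\cap U$ ($U$ an affine subspace) containing $p_1,\dots,p_m$, and $V$ is the affine hull of $T\cap V$. Let $V_0$ be the linear subspace parallel to $V$ and let $N_T(x)=\{u\in\mathbb{R}^n:\langle u,y-x\rangle\le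 0\text{ for all }y\in T\}$. Then $\dim V=m-1$; hence $p$ is maximally spanning, i.e. $\dim\operatorname{conv}\{p_1,\dots,p_m\}=m-1$, and $m\le n+1$. Moreover $$\dim\bigl(N_T(p_j)\cap V_0\bigr)=1\qquad\text{for all }j\in\{1,\dots,m\},$$ where the dimension of a convex set is that of its affine hull. In particular, if $m=n+1$, then every $p_j$ is a smooth boundary point of $T$, i.e. there is exactly one supporting hyperplane of $T$ through $p_j$. -/

import Mathlib

/-- `H` is a supporting hyperplane of `T`: it meets `T`, and `T` lies in one of the two closed
half-spaces bounded by `H`. -/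
def IsSupportingHyperplane {n : ℕ} (T H : Set (EuclideanSpace ℝ (Fin n))) : Prop :=
  (H ∩ T).Nonempty ∧
    ∃ (u : EuclideanSpace ℝ (Fin n)) (c : ℝ), u ≠ 0 ∧ H = {x | inner ℝ u x = c} ∧
      ∀ y ∈ T, inner ℝ u y ≤ c

/-- The point `x` is a smooth boundary point of `T`: there is exactly one supporting hyperplane
of `T` through `x`. -/
def IsSmoothBoundaryPoint {n : ℕ} (T : Set (EuclideanSpace ℝ (Fin n)))
    (x : EuclideanSpace ℝ (Fin n)) : Prop :=
  x ∈ frontier T ∧ ∃! H : Set (EuclideanSpace ℝ (Fin n)), IsSupportingHyperplane T H ∧ x ∈ H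

/-- The outer normal cone of `T` at `x`. -/
def outerNormalCone {n : ℕ} (T : Set (EuclideanSpace ℝ (Fin n)))
    (x : EuclideanSpace ℝ (Fin n)) : Set (EuclideanSpace ℝ (Fin n)) :=
  {u | ∀ y ∈ T, inner ℝ u (y - x) ≤ 0}

/-- The dimension of a (nonempty, convex) set: the dimension of its affine hull. -/
noncomputable def convexDim {n : ℕ} (S : Set (EuclideanSpace ℝ (Fin n))) : ℕ :=
  Module.finrank ℝ (affineSpan ℝ S).direction

/-- The closed polygonal line with vertices `p 0, …, p (m - 1)`, in this order, is a closed
billiard trajectory in `T`. Indices are cyclic: `finRotate m j` is the index after `j` and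
`(finRotate m).symm j` the one before it (modulo `m`). -/
def IsClosedBilliardTrajectory {n m : ℕ} (T : Set (EuclideanSpace ℝ (Fin n)))
    (p : Fin m → EuclideanSpace ℝ (Fin n)) : Prop :=
  2 ≤ m ∧ Function.Injective p ∧ (∀ j, p j ∈ frontier T) ∧
    ∀ j,
      (∃ H : Set (EuclideanSpace ℝ (Fin n)), IsSupportingHyperplane T H ∧ p j ∈ H ∧
        ∀ q ∈ H,
          ‖p j - p ((finRotate m).symm j)‖ + ‖p (finRotate m j) - p j‖ ≤
            ‖q - p ((finRotate m).symm j)‖ + ‖p (finRotate m j) - q‖) ∧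
      p j ∉ segment ℝ (p ((finRotate m).symm j)) (p (finRotate m j))

/-- The length of the closed polygonal line with vertices `p 0, …, p (m - 1)`. -/
noncomputable def closedLength {n m : ℕ} (p : Fin m → EuclideanSpace ℝ (Fin n)) : ℝ :=
  ∑ j, ‖p (finRotate m j) - p j‖

/-- A closed billiard trajectory in `T` that is shortest among all closed billiard trajectories
in `T`, with any number of bouncing points. -/
def IsLengthMinimizingTrajectory {n m : ℕ} (T : Set (EuclideanSpace ℝ (Fin n)))
    (p : Fin m → EuclideanSpace ℝ (Fin n)) : Prop :=
  IsClosedBilliardTrajectory T p ∧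
    ∀ (k : ℕ) (q : Fin k → EuclideanSpace ℝ (Fin n)),
      IsClosedBilliardTrajectory T q → closedLength p ≤ closedLength q

/-- The affine subspace `V` cuts out the smallest affine section `T ∩ V` of `T` that contains the
points `p j`. A section determines the subspace only if the subspace is its affine hull (a plane
that touches a cube along an edge cuts out the same set as the line through the edge), so `V` is
required to be the affine hull of `T ∩ V`. -/
def CutsOutSmallestSection {n m : ℕ} (T : Set (EuclideanSpace ℝ (Fin n)))
    (p : Fin m → EuclideanSpace ℝ (Fin n))
    (V : AffineSubspace ℝ (EuclideanSpace ℝ (Fin n))) : Prop :=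
  Set.range p ⊆ T ∩ (V : Set (EuclideanSpace ℝ (Fin n))) ∧
    (∀ U : AffineSubspace ℝ (EuclideanSpace ℝ (Fin n)),
      Set.range p ⊆ T ∩ (U : Set (EuclideanSpace ℝ (Fin n))) →
        T ∩ (V : Set (EuclideanSpace ℝ (Fin n))) ⊆ T ∩ (U : Set (EuclideanSpace ℝ (Fin n)))) ∧
    affineSpan ℝ (T ∩ (V : Set (EuclideanSpace ℝ (Fin n)))) = V

/-!
The proof works with certificates of non-translatability. If a closed polygonal line `q` is given
together with vectors `u i`, not all zero, such that `∑ u i = 0` and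
`∑ h_T (u i) ≤ ∑ ⟪u i, q i⟫`, where `h_T` is the support function, then `q` cannot be translated
into the interior of `T`; the pair is then called an obstruction (`IsObstruction`).

A billiard trajectory `p` carries a canonical obstruction. The reflection law says that its turning
vectors `turning p j` (direction of the incoming edge minus direction of the outgoing edge) are
nonzero outer normals of `T` at `p j`, and they sum to zero because the edge directions telescope
cyclically. They also form the gradient of the length.

Conversely, no obstructed line is shorter than all billiard trajectories
(`IsObstruction.exists_billiard_le`). By compactness there is a shortest obstructed line with a
given number of vertices. If one of its certificate vectors vanishes, the vertex can be dropped,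
and two equal vertices can be merged, so induction applies. Otherwise the line fits into `T` after
a translation, since by Hahn-Banach it could be shrunk if it did not. The certificate vectors are
then outer normals at the vertices, and the Lagrange multiplier rule makes them positive multiples
of the turning vectors, which is the reflection law.

Hence a length-minimizing trajectory `p` is shortest among all obstructed lines. A nontrivial
nonnegative relation between its turning vectors that omits a vertex would be an obstruction for
the strictly shorter line without this vertex. Therefore `∑ turning p j = 0` is the only linear
relation up to scaling, and the turning vectors span a space of dimension `m - 1`. As they lie in
the direction of the affine hull of `p`, which is `V`, this direction has dimension `m - 1`.
Finally, if `w` is an outer normal at `p j` parallel to `V`, a large multiple of the turning vectors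
can be modified to an obstruction `u` of `p` with `u j = C • turning p j + w`, and the multiplier
rule for `u` shows that `w` is a multiple of `turning p j`
(`IsLengthMinimizingTrajectory.mem_span_turning`).
-/

section Polygons

variable {n m : ℕ}

/-! ### Edge directions and turning vectors of a closed polygonal line -/

/-- The unit vector along the edge that leaves the vertex `q j` (zero if that edge is
degenerate). -/
noncomputable def edgeDirection (q : Fin m → EuclideanSpace ℝ (Fin n)) (j : Fin m) :
    EuclideanSpace ℝ (Fin n) :=
  ‖q (finRotate m j) - q j‖⁻¹ • (q (finRotate m j) - q j)

/-- The turning vector of a closed polygonal line at the vertex `q j`: the direction of the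
incoming edge minus that of the outgoing one. The family of turning vectors is the gradient of
`closedLength` at `q`. -/
noncomputable def turning (q : Fin m → EuclideanSpace ℝ (Fin n)) (j : Fin m) :
    EuclideanSpace ℝ (Fin n) :=
  edgeDirection q ((finRotate m).symm j) - edgeDirection q j

lemma finRotate_apply_ne (hm : 2 ≤ m) (j : Fin m) : finRotate m j ≠ j := by
  obtain ⟨k, rfl⟩ : ∃ k, m = k + 2 := ⟨m - 2, by omega⟩
  rw [finRotate_apply]
  simp

lemma inner_inv_norm_smul_self {E : Type*} [NormedAddCommGroup E] [InnerProductSpace ℝ E] (x : E) :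
    inner ℝ (‖x‖⁻¹ • x) x = ‖x‖ := by
  rw [real_inner_smul_left, real_inner_self_eq_norm_sq]
  by_cases h : ‖x‖ = 0
  · simp [h]
  · field_simp

lemma inner_inv_norm_smul_le {E : Type*} [NormedAddCommGroup E] [InnerProductSpace ℝ E] (x y : E) :
    inner ℝ (‖x‖⁻¹ • x) y ≤ ‖y‖ := by
  have h1 : ‖‖x‖⁻¹ • x‖ ≤ 1 := by
    rw [norm_smul, norm_inv, norm_norm]
    exact inv_mul_le_one
  calc inner ℝ (‖x‖⁻¹ • x) y ≤ ‖‖x‖⁻¹ • x‖ * ‖y‖ := real_inner_le_norm _ _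
    _ ≤ 1 * ‖y‖ := by gcongr
    _ = ‖y‖ := one_mul _

lemma hasDerivAt_norm_add_smul {E : Type*} [NormedAddCommGroup E] [InnerProductSpace ℝ E]
    {x : E} (hx : x ≠ 0) (v : E) :
    HasDerivAt (fun t : ℝ => ‖x + t • v‖) (inner ℝ (‖x‖⁻¹ • x) v) 0 := by
  have h1 : HasDerivAt (fun t : ℝ => x + t • v) v 0 := by
    simpa using ((hasDerivAt_id (0 : ℝ)).smul_const v).const_add x
  have h2 := h1.norm_sq.sqrt (by simpa using hx)
  have h3 : (fun t : ℝ => √(‖x + t • v‖ ^ 2)) = fun t => ‖x + t • v‖ := by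
    ext t
    exact Real.sqrt_sq (norm_nonneg _)
  rw [h3] at h2
  convert h2 using 1
  simp only [zero_smul, add_zero, Real.sqrt_sq (norm_nonneg x)]
  rw [real_inner_smul_left]
  ring

lemma sum_inner_turning (q v : Fin m → EuclideanSpace ℝ (Fin n)) :
    ∑ j, inner ℝ (turning q j) (v j)
      = ∑ j, inner ℝ (edgeDirection q j) (v (finRotate m j) - v j) := by
  simp only [turning, inner_sub_left, inner_sub_right, Finset.sum_sub_distrib]
  congr 1
  rw [← Equiv.sum_comp (finRotate m)]
  simp only [Equiv.symm_apply_apply]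

lemma sum_turning (q : Fin m → EuclideanSpace ℝ (Fin n)) : ∑ j, turning q j = 0 := by
  simp only [turning, Finset.sum_sub_distrib]
  rw [Equiv.sum_comp (finRotate m).symm (edgeDirection q), sub_self]

lemma sum_inner_turning_self (q : Fin m → EuclideanSpace ℝ (Fin n)) :
    ∑ j, inner ℝ (turning q j) (q j) = closedLength q := by
  rw [sum_inner_turning]
  exact Finset.sum_congr rfl fun j _ => inner_inv_norm_smul_self _

lemma turning_eq (q : Fin m → EuclideanSpace ℝ (Fin n)) (j : Fin m) :
    turning q j = ‖q j - q ((finRotate m).symm j)‖⁻¹ • (q j - q ((finRotate m).symm j))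
      - ‖q (finRotate m j) - q j‖⁻¹ • (q (finRotate m j) - q j) := by
  simp only [turning, edgeDirection, Equiv.apply_symm_apply]

/-- Both conditions say that the incoming and the outgoing edge point in the same direction. -/
lemma turning_eq_zero_iff {q : Fin m → EuclideanSpace ℝ (Fin n)}
    (hq : ∀ j, q (finRotate m j) ≠ q j) (j : Fin m) :
    turning q j = 0 ↔
      q j ∈ segment ℝ (q ((finRotate m).symm j)) (q (finRotate m j)) := by
  have h1 : q j - q ((finRotate m).symm j) ≠ 0 := by
    simpa only [sub_ne_zero, Equiv.apply_symm_apply] using hq ((finRotate m).symm j)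
  rw [mem_segment_iff_sameRay, sameRay_iff_inv_norm_smul_eq_of_ne h1 (sub_ne_zero.2 (hq j)),
    turning_eq, sub_eq_zero]

lemma closedLength_smul (s : ℝ) (hs : 0 ≤ s) (q : Fin m → EuclideanSpace ℝ (Fin n)) :
    closedLength (s • q) = s * closedLength q := by
  simp [closedLength, ← smul_sub, norm_smul, abs_of_nonneg hs, Finset.mul_sum]

lemma closedLength_add_const (q : Fin m → EuclideanSpace ℝ (Fin n))
    (t : EuclideanSpace ℝ (Fin n)) : closedLength (fun i => q i + t) = closedLength q := by
  simp [closedLength]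

lemma turning_add_const (q : Fin m → EuclideanSpace ℝ (Fin n))
    (t : EuclideanSpace ℝ (Fin n)) : turning (fun i => q i + t) = turning q := by
  ext1 j
  simp [turning, edgeDirection]

lemma closedLength_nonneg (q : Fin m → EuclideanSpace ℝ (Fin n)) : 0 ≤ closedLength q :=
  Finset.sum_nonneg fun _ _ => norm_nonneg _

lemma continuous_closedLength :
    Continuous (closedLength : (Fin m → EuclideanSpace ℝ (Fin n)) → ℝ) := by
  unfold closedLength
  fun_prop

lemma norm_sub_zero_le_mul_closedLength {k : ℕ} (q : Fin (k + 1) → EuclideanSpace ℝ (Fin n))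
    (i : Fin (k + 1)) : ‖q i - q 0‖ ≤ i * closedLength q := by
  induction i using Fin.induction with
  | zero => simp
  | succ i ih =>
    have h1 : ‖q i.succ - q i.castSucc‖ ≤ closedLength q := by
      have := Finset.single_le_sum (f := fun j => ‖q (finRotate (k + 1) j) - q j‖)
        (fun _ _ => norm_nonneg _) (Finset.mem_univ i.castSucc)
      simpa [finRotate_apply, closedLength] using this
    calc ‖q i.succ - q 0‖ = ‖(q i.succ - q i.castSucc) + (q i.castSucc - q 0)‖ := by
          rw [sub_add_sub_cancel]
      _ ≤ closedLength q + (i.castSucc : ℕ) * closedLength q :=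
          (norm_add_le _ _).trans (add_le_add h1 ih)
      _ = (i.succ : ℕ) * closedLength q := by push_cast [Fin.val_succ, Fin.val_castSucc]; ring

/-- If every family orthogonal to `u` is orthogonal to `g`, then `g` is a multiple of `u`. The
families live in `ι → E`, which carries no inner product in Mathlib, hence the sums. -/
lemma eq_smul_of_orthogonal {ι E : Type*} [Fintype ι] [NormedAddCommGroup E]
    [InnerProductSpace ℝ E] {g u : ι → E}
    (h : ∀ v : ι → E, ∑ i, inner ℝ (u i) (v i) = 0 → ∑ i, inner ℝ (g i) (v i) = 0) :
    ∃ r : ℝ, g = r • u := by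
  by_cases hu : ∑ i, inner ℝ (u i) (u i) = 0
  · have hu' : u = 0 := by
      rw [Finset.sum_eq_zero_iff_of_nonneg fun i _ => real_inner_self_nonneg] at hu
      ext1 i
      simpa using hu i (Finset.mem_univ i)
    have hg := h g (by simp [hu'])
    rw [Finset.sum_eq_zero_iff_of_nonneg fun i _ => real_inner_self_nonneg] at hg
    refine ⟨0, ?_⟩
    ext1 i
    simpa using hg i (Finset.mem_univ i)
  · set r : ℝ := (∑ i, inner ℝ (u i) (g i)) / ∑ i, inner ℝ (u i) (u i) with hr
    have h1 : ∑ i, inner ℝ (u i) (g i - r • u i) = 0 := by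
      simp only [inner_sub_right, real_inner_smul_right, Finset.sum_sub_distrib, ← Finset.mul_sum]
      rw [hr, div_mul_cancel₀ _ hu, sub_self]
    have h2 := h _ h1
    have h3 : ∑ i, inner ℝ (g i - r • u i) (g i - r • u i) = 0 := by
      have : ∀ i, inner ℝ (g i - r • u i) (g i - r • u i)
          = inner ℝ (g i) (g i - r • u i) - r * inner ℝ (u i) (g i - r • u i) := fun i => by
        rw [inner_sub_left, real_inner_smul_left]
      simp only [this, Finset.sum_sub_distrib, ← Finset.mul_sum, h1, h2, mul_zero, sub_zero]
    rw [Finset.sum_eq_zero_iff_of_nonneg fun i _ => real_inner_self_nonneg] at h3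
    refine ⟨r, ?_⟩
    ext1 i
    simpa [sub_eq_zero] using h3 i (Finset.mem_univ i)

/-- Lagrange multiplier rule: if `q` is shortest among the polygonal lines with the same number of
vertices on which the linear form `∑ ⟪u i, · i⟫` takes the value it takes at `q`, then the gradient
of the length at `q` is a multiple of `u`. -/
lemma exists_turning_eq_smul {q u : Fin m → EuclideanSpace ℝ (Fin n)}
    (hq : ∀ j, q (finRotate m j) ≠ q j)
    (hmin : ∀ q' : Fin m → EuclideanSpace ℝ (Fin n),
      ∑ i, inner ℝ (u i) (q' i) = ∑ i, inner ℝ (u i) (q i) → closedLength q ≤ closedLength q') :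
    ∃ r : ℝ, turning q = r • u := by
  refine eq_smul_of_orthogonal fun v hv => ?_
  have h1 : HasDerivAt (fun t : ℝ => closedLength (q + t • v))
      (∑ j, inner ℝ (turning q j) (v j)) 0 := by
    rw [sum_inner_turning]
    have := HasDerivAt.fun_sum (u := Finset.univ) (x := (0 : ℝ)) fun j _ =>
      hasDerivAt_norm_add_smul (sub_ne_zero.2 (hq j)) (v (finRotate m j) - v j)
    have h2 : (fun t : ℝ => closedLength (q + t • v)) = fun t => ∑ j,
        ‖q (finRotate m j) - q j + t • (v (finRotate m j) - v j)‖ := by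
      ext t
      simp only [closedLength, Pi.add_apply, Pi.smul_apply]
      refine Finset.sum_congr rfl fun j _ => ?_
      congr 1
      module
    rwa [h2]
  refine IsLocalMin.hasDerivAt_eq_zero (Filter.Eventually.of_forall fun t => ?_) h1
  simp only [zero_smul, add_zero]
  refine hmin _ ?_
  simp [inner_add_right, real_inner_smul_right, Finset.sum_add_distrib, ← Finset.mul_sum, hv]

/-! ### The reflection law in terms of normal vectors -/

/-- For a polygonal line in `T` with nondegenerate edges, the reflection law at a vertex says that
the turning vector there is an outer normal of `T`: minimality along the hyperplane makes the
turning vector orthogonal to it, and the sign is right because both neighbours lie in `T`. -/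
lemma turning_mem_outerNormalCone {T : Set (EuclideanSpace ℝ (Fin n))}
    {q : Fin m → EuclideanSpace ℝ (Fin n)} (hT : ∀ j, q j ∈ T)
    (hq : ∀ j, q (finRotate m j) ≠ q j) (j : Fin m) {H : Set (EuclideanSpace ℝ (Fin n))}
    (hH : IsSupportingHyperplane T H) (hj : q j ∈ H)
    (hmin : ∀ x ∈ H,
      ‖q j - q ((finRotate m).symm j)‖ + ‖q (finRotate m j) - q j‖ ≤
        ‖x - q ((finRotate m).symm j)‖ + ‖q (finRotate m j) - x‖) :
    turning q j ∈ outerNormalCone T (q j) := by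
  obtain ⟨-, u, c, hu, rfl, hle⟩ := hH
  have hc : inner ℝ u (q j) = c := hj
  have h1 : q j - q ((finRotate m).symm j) ≠ 0 := by
    simpa only [sub_ne_zero, Equiv.apply_symm_apply] using hq ((finRotate m).symm j)
  have h2 : q (finRotate m j) - q j ≠ 0 := sub_ne_zero.2 (hq j)
  obtain ⟨r, hr⟩ : ∃ r : ℝ, (fun _ : Unit => turning q j) = r • fun _ => u := by
    refine eq_smul_of_orthogonal fun v hv => ?_
    replace hv : inner ℝ u (v ()) = 0 := by simpa using hv
    have h3 := (hasDerivAt_norm_add_smul h1 (v ())).add (hasDerivAt_norm_add_smul h2 (-v ()))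
    rw [inner_neg_right, ← sub_eq_add_neg, ← inner_sub_left, ← turning_eq] at h3
    simp only [Finset.univ_unique, Finset.sum_singleton]
    refine IsLocalMin.hasDerivAt_eq_zero (Filter.Eventually.of_forall fun t => ?_) h3
    have h4 := hmin (q j + t • v ()) (by simp [inner_add_right, real_inner_smul_right, hv, hc])
    simp only [Pi.add_apply, zero_smul, add_zero]
    rwa [show q j - q ((finRotate m).symm j) + t • v () = q j + t • v () - q ((finRotate m).symm j)
      by abel, show q (finRotate m j) - q j + t • -v () = q (finRotate m j) - (q j + t • v ())
      by module]
  replace hr : turning q j = r • u := congrFun hr ()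
  have hr0 : 0 ≤ r := by
    have hpos : 0 < inner ℝ u u := real_inner_self_pos.2 hu
    have h5 : 0 ≤ inner ℝ u (turning q j) := by
      have h6 := hle _ (hT ((finRotate m).symm j))
      have h7 := hle _ (hT (finRotate m j))
      rw [turning_eq, inner_sub_right, real_inner_smul_right, real_inner_smul_right,
        inner_sub_right, inner_sub_right, hc, sub_nonneg]
      exact (mul_nonpos_of_nonneg_of_nonpos (by positivity) (by linarith)).trans
        (mul_nonneg (by positivity) (by linarith))
    rw [hr, real_inner_smul_right] at h5
    exact nonneg_of_mul_nonneg_left h5 hpos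
  intro y hy
  rw [hr, real_inner_smul_left, inner_sub_right, hc]
  exact mul_nonpos_of_nonneg_of_nonpos hr0 (by linarith [hle y hy])

lemma mem_frontier_of_mem_outerNormalCone {T : Set (EuclideanSpace ℝ (Fin n))}
    {x u : EuclideanSpace ℝ (Fin n)} (hx : x ∈ T) (hu : u ∈ outerNormalCone T x) (hu0 : u ≠ 0) :
    x ∈ frontier T := by
  refine ⟨subset_closure hx, fun hint => ?_⟩
  have h1 : ∀ᶠ t : ℝ in nhds 0, x + t • u ∈ T := by
    have : Filter.Tendsto (fun t : ℝ => x + t • u) (nhds 0) (nhds (x + (0 : ℝ) • u)) :=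
      Continuous.tendsto (by fun_prop) 0
    rw [zero_smul, add_zero] at this
    exact this (mem_interior_iff_mem_nhds.1 hint)
  obtain ⟨t, ht, ht0⟩ := (Filter.Eventually.and (h1.filter_mono nhdsWithin_le_nhds)
    (self_mem_nhdsWithin (s := Set.Ioi (0 : ℝ)))).exists
  have := hu _ ht
  rw [add_sub_cancel_left, real_inner_smul_right] at this
  exact absurd this (not_le.2 (mul_pos ht0 (real_inner_self_pos.2 hu0)))

lemma isSupportingHyperplane_of_mem_outerNormalCone {T : Set (EuclideanSpace ℝ (Fin n))}
    {x u : EuclideanSpace ℝ (Fin n)} (hx : x ∈ T) (hu : u ∈ outerNormalCone T x) (hu0 : u ≠ 0) :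
    IsSupportingHyperplane T {y | inner ℝ u y = inner ℝ u x} :=
  ⟨⟨x, rfl, hx⟩, u, _, hu0, rfl, fun y hy => by
    have := hu y hy
    rwa [inner_sub_right, sub_nonpos] at this⟩

/-- A polygonal line in `T` with distinct vertices is a closed billiard trajectory as soon as its
turning vectors are nonzero outer normals, by convexity of the length. -/
lemma isClosedBilliardTrajectory_of_turning {T : Set (EuclideanSpace ℝ (Fin n))} (hm : 2 ≤ m)
    {q : Fin m → EuclideanSpace ℝ (Fin n)} (hinj : Function.Injective q) (hT : ∀ j, q j ∈ T)
    (h0 : ∀ j, turning q j ≠ 0) (hN : ∀ j, turning q j ∈ outerNormalCone T (q j)) :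
    IsClosedBilliardTrajectory T q := by
  have hq : ∀ j, q (finRotate m j) ≠ q j := fun j h => finRotate_apply_ne hm j (hinj h)
  refine ⟨hm, hinj, fun j => mem_frontier_of_mem_outerNormalCone (hT j) (hN j) (h0 j), fun j =>
    ⟨⟨_, isSupportingHyperplane_of_mem_outerNormalCone (hT j) (hN j) (h0 j), rfl, fun x hx => ?_⟩,
      fun h => h0 j ((turning_eq_zero_iff hq j).2 h)⟩⟩
  have hx' : inner ℝ (turning q j) (x - q j) = 0 := by
    rw [inner_sub_right, sub_eq_zero]; exact hx
  have h1 := inner_inv_norm_smul_le (q j - q ((finRotate m).symm j))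
    (x - q ((finRotate m).symm j))
  have h2 := inner_inv_norm_smul_le (q (finRotate m j) - q j) (q (finRotate m j) - x)
  have h3 := inner_inv_norm_smul_self (q j - q ((finRotate m).symm j))
  have h4 := inner_inv_norm_smul_self (q (finRotate m j) - q j)
  rw [turning_eq, inner_sub_left] at hx'
  have h5 : x - q ((finRotate m).symm j) = (x - q j) + (q j - q ((finRotate m).symm j)) := by abel
  have h6 : q (finRotate m j) - x = (q (finRotate m j) - q j) - (x - q j) := by abel
  rw [h5, inner_add_right, ← h5] at h1
  rw [h6, inner_sub_right, ← h6] at h2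
  linarith

end Polygons

section Obstructions

variable {n m : ℕ} {T : Set (EuclideanSpace ℝ (Fin n))}

/-! ### Certificates that a polygonal line has no translate in the interior of a convex body -/

/-- A certificate that the polygonal line `q` cannot be translated into the interior of `T`:
vectors `u i`, not all zero and with sum zero, such that `∑ h_T (u i) ≤ ∑ ⟪u i, q i⟫`, where
`h_T` is the support function of `T`. Since the `u i` add up to zero, the right-hand side does not
change when `q` is translated. The inequality is spelled out without support functions, as a
family of inequalities indexed by the points of `T ^ m`. -/
structure IsObstruction (T : Set (EuclideanSpace ℝ (Fin n)))
    (q u : Fin m → EuclideanSpace ℝ (Fin n)) : Prop where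
  ne_zero : u ≠ 0
  sum_eq_zero : ∑ i, u i = 0
  sum_inner_le : ∀ y : Fin m → EuclideanSpace ℝ (Fin n), (∀ i, y i ∈ T) →
    ∑ i, inner ℝ (u i) (y i) ≤ ∑ i, inner ℝ (u i) (q i)

namespace IsObstruction

variable {q u : Fin m → EuclideanSpace ℝ (Fin n)}

lemma of_mem_outerNormalCone (hu : u ≠ 0) (hsum : ∑ i, u i = 0)
    (hN : ∀ i, u i ∈ outerNormalCone T (q i)) : IsObstruction T q u :=
  ⟨hu, hsum, fun y hy => Finset.sum_le_sum fun i _ => by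
    have := hN i (y i) (hy i)
    rwa [inner_sub_right, sub_nonpos] at this⟩

lemma sum_inner_const (h : IsObstruction T q u) (c : EuclideanSpace ℝ (Fin n)) :
    ∑ i, inner ℝ (u i) c = 0 := by
  rw [← sum_inner, h.sum_eq_zero, inner_zero_left]

lemma add_const (h : IsObstruction T q u) (c : EuclideanSpace ℝ (Fin n)) :
    IsObstruction T (fun i => q i + c) u := by
  refine ⟨h.ne_zero, h.sum_eq_zero, fun y hy => ?_⟩
  simpa [inner_add_right, Finset.sum_add_distrib, h.sum_inner_const] using h.sum_inner_le y hy

lemma smul_right (h : IsObstruction T q u) {r : ℝ} (hr : 0 < r) : IsObstruction T q (r • u) := by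
  refine ⟨smul_ne_zero hr.ne' h.ne_zero, ?_, fun y hy => ?_⟩
  · simp [← Finset.smul_sum, h.sum_eq_zero]
  · simp only [Pi.smul_apply, real_inner_smul_left, ← Finset.mul_sum]
    exact mul_le_mul_of_nonneg_left (h.sum_inner_le y hy) hr.le

/-- The point of `T ^ m` obtained from an interior point of `T` by a small step in direction `u`
shows that `∑ h_T (u i)` is positive. -/
lemma sum_inner_pos (hint : (interior T).Nonempty) (h : IsObstruction T q u) :
    0 < ∑ i, inner ℝ (u i) (q i) := by
  obtain ⟨c, hc⟩ := hint
  have h1 : ∀ i, ∀ᶠ t : ℝ in nhds 0, c + t • u i ∈ T := fun i => by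
    have : Filter.Tendsto (fun t : ℝ => c + t • u i) (nhds 0) (nhds (c + (0 : ℝ) • u i)) :=
      Continuous.tendsto (by fun_prop) 0
    rw [zero_smul, add_zero] at this
    exact this (mem_interior_iff_mem_nhds.1 hc)
  obtain ⟨t, ht, ht0⟩ := (Filter.Eventually.and
    ((Filter.eventually_all.2 h1).filter_mono nhdsWithin_le_nhds)
    (self_mem_nhdsWithin (s := Set.Ioi (0 : ℝ)))).exists
  refine lt_of_lt_of_le ?_ (h.sum_inner_le _ ht)
  simp only [inner_add_right, Finset.sum_add_distrib, h.sum_inner_const, real_inner_smul_right,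
    zero_add, ← Finset.mul_sum]
  refine mul_pos ht0 (lt_of_le_of_ne (Finset.sum_nonneg fun i _ => real_inner_self_nonneg) ?_)
  intro h0
  rw [eq_comm, Finset.sum_eq_zero_iff_of_nonneg fun i _ => real_inner_self_nonneg] at h0
  refine h.ne_zero (funext fun i => ?_)
  simpa using h0 i (Finset.mem_univ i)

lemma closedLength_pos (hint : (interior T).Nonempty) (h : IsObstruction T q u) :
    0 < closedLength q := by
  refine lt_of_le_of_ne (closedLength_nonneg q) fun h0 => ?_
  cases m with
  | zero => exact h.ne_zero (Subsingleton.elim _ _)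
  | succ k =>
    have h1 : ∀ i, q i = q 0 := fun i => by
      have := norm_sub_zero_le_mul_closedLength q i
      rw [← h0, mul_zero, norm_le_zero_iff, sub_eq_zero] at this
      exact this
    have h2 := h.sum_inner_pos hint
    rw [Finset.sum_congr rfl fun i _ => by rw [h1 i], h.sum_inner_const] at h2
    exact lt_irrefl _ h2

lemma comp_perm (h : IsObstruction T q u) (e : Equiv.Perm (Fin m)) :
    IsObstruction T (q ∘ e) (u ∘ e) := by
  refine ⟨fun h0 => h.ne_zero ?_, ?_, fun y hy => ?_⟩
  · ext1 i
    simpa using congrFun h0 (e.symm i)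
  · exact (Equiv.sum_comp e u).trans h.sum_eq_zero
  · have h1 := h.sum_inner_le (y ∘ e.symm) fun i => hy _
    rw [← Equiv.sum_comp e, ← Equiv.sum_comp e fun i => inner ℝ (u i) (q i)] at h1
    simpa using h1

end IsObstruction

lemma closedLength_comp_addRight {k : ℕ} (q : Fin (k + 1) → EuclideanSpace ℝ (Fin n))
    (c : Fin (k + 1)) : closedLength (q ∘ Equiv.addRight c) = closedLength q := by
  unfold closedLength
  rw [← Equiv.sum_comp (Equiv.addRight c) fun j => ‖q (finRotate (k + 1) j) - q j‖]
  refine Finset.sum_congr rfl fun j _ => ?_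
  simp only [Function.comp_apply, Equiv.coe_addRight, finRotate_apply, add_right_comm]

lemma closedLength_castSucc_add {k : ℕ} (q : Fin (k + 2) → EuclideanSpace ℝ (Fin n)) :
    closedLength (q ∘ Fin.castSucc) + (‖q (Fin.last _) - q (Fin.last k).castSucc‖
      + ‖q 0 - q (Fin.last _)‖) = closedLength q + ‖q 0 - q (Fin.last k).castSucc‖ := by
  simp only [closedLength, finRotate_apply, Fin.sum_univ_castSucc, Function.comp_apply,
    Fin.coeSucc_eq_succ, Fin.last_add_one, Fin.castSucc_zero, Fin.succ_last]
  simp only [← Fin.succ_castSucc]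
  ring

/-- A vertex with zero coefficient in the certificate can be left out. The indices are rotated so
that the omitted vertex becomes the last one. -/
lemma IsObstruction.exists_drop_vertex {k : ℕ} {q u : Fin (k + 2) → EuclideanSpace ℝ (Fin n)}
    (hT : T.Nonempty) (h : IsObstruction T q u) {j : Fin (k + 2)} (hj : u j = 0) :
    ∃ q' u' : Fin (k + 1) → EuclideanSpace ℝ (Fin n), IsObstruction T q' u' ∧
      closedLength q' + (‖q j - q ((finRotate (k + 2)).symm j)‖ + ‖q (finRotate (k + 2) j) - q j‖)
        = closedLength q + ‖q (finRotate (k + 2) j) - q ((finRotate (k + 2)).symm j)‖ := by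
  set c : Fin (k + 2) := j - Fin.last _ with hc
  have hlast : Fin.last (k + 1) + c = j := by rw [hc]; abel
  have hprev : (Fin.last k).castSucc + c = (finRotate (k + 2)).symm j := by
    rw [Equiv.eq_symm_apply, finRotate_apply, add_right_comm, Fin.coeSucc_eq_succ, Fin.succ_last,
      hlast]
  have hnext : 0 + c = finRotate (k + 2) j := by
    rw [finRotate_apply, ← hlast, add_right_comm, Fin.last_add_one]
  have h1 := h.comp_perm (Equiv.addRight c)
  have h0 : (u ∘ Equiv.addRight c) (Fin.last _) = 0 := by
    simp only [Function.comp_apply, Equiv.coe_addRight, hlast, hj]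
  refine ⟨q ∘ Equiv.addRight c ∘ Fin.castSucc, u ∘ Equiv.addRight c ∘ Fin.castSucc,
    ⟨fun h2 => h1.ne_zero ?_, ?_, fun y hy => ?_⟩, ?_⟩
  · ext1 i
    refine Fin.lastCases h0 (fun i => ?_) i
    exact congrFun h2 i
  · have := h1.sum_eq_zero
    rwa [Fin.sum_univ_castSucc, h0, add_zero] at this
  · obtain ⟨z, hz⟩ := hT
    have := h1.sum_inner_le (Fin.snoc y z) fun i => by
      refine Fin.lastCases ?_ (fun i => ?_) i
      · simpa using hz
      · simpa using hy i
    rw [Fin.sum_univ_castSucc (n := k + 1), Fin.sum_univ_castSucc (n := k + 1), h0] at this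
    simp only [Fin.snoc_castSucc, inner_zero_left, add_zero] at this
    exact this
  · have := closedLength_castSucc_add (q ∘ Equiv.addRight c)
    rw [closedLength_comp_addRight] at this
    simp only [Function.comp_apply, Equiv.coe_addRight, hlast, hprev, hnext] at this
    exact this

/-- If two vertices coincide, their certificate vectors can be added at one of them. -/
lemma IsObstruction.merge (hint : (interior T).Nonempty)
    {q u : Fin m → EuclideanSpace ℝ (Fin n)} (h : IsObstruction T q u) {i j : Fin m}
    (hq : q i = q j) :
    IsObstruction T q (u + Pi.single i (u j) - Pi.single j (u j)) := by
  have key : ∀ y : Fin m → EuclideanSpace ℝ (Fin n),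
      ∑ l, inner ℝ ((u + Pi.single i (u j) - Pi.single j (u j) :
          Fin m → EuclideanSpace ℝ (Fin n)) l) (y l)
        = ∑ l, inner ℝ (u l) (Function.update y j (y i) l) := fun y => by
    have h1 : ∀ (a : Fin m) (v : EuclideanSpace ℝ (Fin n)),
        ∑ l, inner ℝ ((Pi.single a v : Fin m → EuclideanSpace ℝ (Fin n)) l) (y l)
          = inner ℝ v (y a) := fun a v => by
      rw [Finset.sum_eq_single a]
      · simp
      · intro b _ hb; simp [hb]
      · simp
    have h2 : ∑ l, inner ℝ (u l) (Function.update y j (y i) l)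
        = ∑ l, inner ℝ (u l) (y l) + inner ℝ (u j) (y i - y j) := by
      rw [← sub_eq_iff_eq_add', ← Finset.sum_sub_distrib, Finset.sum_eq_single j]
      · simp [inner_sub_right]
      · intro b _ hb; simp [hb]
      · simp
    simp only [Pi.add_apply, Pi.sub_apply, inner_add_left, inner_sub_left,
      Finset.sum_add_distrib, Finset.sum_sub_distrib, h1, h2, inner_sub_right]
    ring
  have hqq : Function.update q j (q i) = q := by rw [hq, Function.update_eq_self]
  refine ⟨fun h0 => ?_, ?_, fun y hy => ?_⟩
  · have h1 := key q
    rw [h0, hqq] at h1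
    simp only [Pi.zero_apply, inner_zero_left, Finset.sum_const_zero] at h1
    exact (h.sum_inner_pos hint).ne h1
  · simp [Finset.sum_add_distrib, h.sum_eq_zero]
  · rw [key, key, hqq]
    refine h.sum_inner_le _ fun l => ?_
    by_cases hl : l = j
    · simpa [hl] using hy i
    · simpa [hl] using hy l

/-! ### Shortest obstructed polygonal lines -/

lemma IsObstruction.exists_minimizer {k : ℕ} {q₀ u₀ : Fin (k + 1) → EuclideanSpace ℝ (Fin n)}
    (h₀ : IsObstruction T q₀ u₀) :
    ∃ q u : Fin (k + 1) → EuclideanSpace ℝ (Fin n), IsObstruction T q u ∧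
      ∀ q' u' : Fin (k + 1) → EuclideanSpace ℝ (Fin n), IsObstruction T q' u' →
        closedLength q ≤ closedLength q' := by
  set R : ℝ := (k + 1 : ℕ) * closedLength q₀ with hR
  let K : Set ((Fin (k + 1) → EuclideanSpace ℝ (Fin n)) ×
      (Fin (k + 1) → EuclideanSpace ℝ (Fin n))) :=
    {x | ‖x.2‖ = 1 ∧ ‖x.1‖ ≤ R ∧ ∑ i, x.2 i = 0 ∧ ∀ y : Fin (k + 1) → EuclideanSpace ℝ (Fin n),
      (∀ i, y i ∈ T) → ∑ i, inner ℝ (x.2 i) (y i) ≤ ∑ i, inner ℝ (x.2 i) (x.1 i)}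
  -- up to translation and scaling of the certificate, a short obstructed line belongs to `K`
  have hK : ∀ q u : Fin (k + 1) → EuclideanSpace ℝ (Fin n), IsObstruction T q u →
      closedLength q ≤ closedLength q₀ →
      ∃ x ∈ K, closedLength x.1 = closedLength q := by
    intro q u h hle
    have hu : 0 < ‖u‖ := norm_pos_iff.2 h.ne_zero
    have h1 := (h.add_const (-q 0)).smul_right (inv_pos.2 hu)
    refine ⟨(fun i => q i + -q 0, ‖u‖⁻¹ • u), ⟨?_, ?_, h1.sum_eq_zero, h1.sum_inner_le⟩,
      closedLength_add_const _ _⟩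
    · rw [norm_smul, norm_inv, norm_norm, inv_mul_cancel₀ hu.ne']
    · have hR0 : 0 ≤ R := mul_nonneg (Nat.cast_nonneg _) (closedLength_nonneg _)
      rw [pi_norm_le_iff_of_nonneg hR0]
      intro i
      change ‖q i + -q 0‖ ≤ R
      rw [← sub_eq_add_neg]
      refine (norm_sub_zero_le_mul_closedLength q i).trans ?_
      rw [hR]
      gcongr
      · exact closedLength_nonneg _
      · exact i.2.le
  have hclosed : IsClosed {x : (Fin (k + 1) → EuclideanSpace ℝ (Fin n)) ×
      (Fin (k + 1) → EuclideanSpace ℝ (Fin n)) |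
        ∀ y : Fin (k + 1) → EuclideanSpace ℝ (Fin n), (∀ i, y i ∈ T) →
          ∑ i, inner ℝ (x.2 i) (y i) ≤ ∑ i, inner ℝ (x.2 i) (x.1 i)} := by
    simp only [Set.ofPred_forall]
    exact isClosed_iInter fun y => isClosed_iInter fun _ =>
      isClosed_le (by fun_prop) (by fun_prop)
  have hcomp : IsCompact K := by
    refine IsCompact.of_isClosed_subset
      ((isCompact_closedBall (0 : Fin (k + 1) → EuclideanSpace ℝ (Fin n)) R).prod
        (isCompact_closedBall (0 : Fin (k + 1) → EuclideanSpace ℝ (Fin n)) 1)) ?_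
      fun x hx => ⟨by simpa using hx.2.1, by simpa using hx.1.le⟩
    refine (isClosed_eq continuous_snd.norm continuous_const).inter
      ((isClosed_le continuous_fst.norm continuous_const).inter
        ((isClosed_eq (continuous_finsetSum _ fun i _ => (continuous_apply i).comp continuous_snd)
          continuous_const).inter hclosed))
  obtain ⟨x₀, hx₀, hx₀len⟩ := hK q₀ u₀ h₀ le_rfl
  obtain ⟨x, hx, hmin⟩ := hcomp.exists_isMinOn ⟨x₀, hx₀⟩
    (f := fun x => closedLength x.1) (continuous_closedLength.comp continuous_fst).continuousOn
  refine ⟨x.1, x.2, ⟨?_, hx.2.2.1, hx.2.2.2⟩, fun q' u' h' => ?_⟩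
  · rw [← norm_pos_iff, hx.1]
    exact one_pos
  · rcases le_total (closedLength q') (closedLength q₀) with hle | hle
    · obtain ⟨x', hx', hlen⟩ := hK q' u' h' hle
      rw [← hlen]
      exact hmin hx'
    · rw [← hx₀len] at hle
      exact (hmin hx₀).trans hle

open scoped Pointwise in
/-- A polygonal line without a translate in `T` is strictly separated from the lines that have
one, so it stays obstructed after shrinking a little. -/
lemma exists_obstruction_smul (hconv : Convex ℝ T) (hcomp : IsCompact T) (hT : T.Nonempty)
    {q : Fin m → EuclideanSpace ℝ (Fin n)} (hq : ¬ ∃ t, ∀ i, q i + t ∈ T) :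
    ∃ s : ℝ, 0 < s ∧ s < 1 ∧ ∃ v, IsObstruction T (s • q) v := by
  let D : Submodule ℝ (Fin m → EuclideanSpace ℝ (Fin n)) :=
    LinearMap.range (LinearMap.pi fun _ => LinearMap.id :
      EuclideanSpace ℝ (Fin n) →ₗ[ℝ] Fin m → EuclideanSpace ℝ (Fin n))
  let Y : Set (Fin m → EuclideanSpace ℝ (Fin n)) := Set.univ.pi fun _ => T
  have hDY : ∀ (t : EuclideanSpace ℝ (Fin n)) (y : Fin m → EuclideanSpace ℝ (Fin n)),
      (∀ i, y i ∈ T) → (fun _ => t) + y ∈ (D : Set (Fin m → EuclideanSpace ℝ (Fin n))) + Y :=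
    fun t y hy => Set.add_mem_add ⟨t, rfl⟩ fun i _ => hy i
  have hmem : q ∉ (D : Set (Fin m → EuclideanSpace ℝ (Fin n))) + Y := by
    rintro ⟨_, ⟨t, rfl⟩, y, hy, rfl⟩
    exact hq ⟨-t, fun i => by simpa using hy i trivial⟩
  obtain ⟨f, c, hfc, hcq⟩ := geometric_hahn_banach_closed_point
    (D.convex.add (convex_pi fun _ _ => hconv))
    (D.closed_of_finiteDimensional.add_right_of_isCompact (isCompact_univ_pi fun _ => hcomp)) hmem
  -- the functional is the pairing with a family `v` of vectors
  let v : Fin m → EuclideanSpace ℝ (Fin n) := fun i =>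
    (InnerProductSpace.toDual ℝ _).symm
      (f.comp (ContinuousLinearMap.single ℝ (fun _ => EuclideanSpace ℝ (Fin n)) i))
  have hf : ∀ x, f x = ∑ i, inner ℝ (v i) (x i) := fun x => by
    have : ∀ i, inner ℝ (v i) (x i) = f (Pi.single i (x i)) := fun i => by
      simp [v]
    simp only [this, ← map_sum, Finset.univ_sum_single]
  have hconst : ∀ t : EuclideanSpace ℝ (Fin n),
      f (fun _ => t) = inner ℝ (∑ i, v i) t := fun t => by rw [hf, sum_inner]
  have hbound : ∀ (t : EuclideanSpace ℝ (Fin n)) (y : Fin m → EuclideanSpace ℝ (Fin n)),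
      (∀ i, y i ∈ T) → inner ℝ (∑ i, v i) t + f y < c := fun t y hy => by
    have := hfc _ (hDY t y hy)
    rwa [map_add, hconst] at this
  obtain ⟨z, hz⟩ := hT
  -- `f` is bounded above on the subspace of translations, hence vanishes there
  have hv : ∑ i, v i = 0 := by
    by_contra hne
    have hpos : 0 < inner ℝ (∑ i, v i) (∑ i, v i) := real_inner_self_pos.2 hne
    have := hbound (((c - f fun _ => z) / inner ℝ (∑ i, v i) (∑ i, v i)) • ∑ i, v i)
      (fun _ => z) fun _ => hz
    rw [real_inner_smul_right, div_mul_cancel₀ _ hpos.ne'] at this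
    linarith
  have hc : 0 < c := by
    have := hbound 0 (fun _ => z) fun _ => hz
    rwa [inner_zero_right, hconst, hv, inner_zero_left, add_zero] at this
  have hfq : 0 < f q := hc.trans hcq
  refine ⟨c / f q, div_pos hc hfq, (div_lt_one hfq).2 hcq, v, fun h0 => ?_, hv, fun y hy => ?_⟩
  · rw [hf q, h0] at hfq
    simp at hfq
  · rw [← hf, ← hf, map_smul, smul_eq_mul, div_mul_cancel₀ _ hfq.ne']
    have := hbound 0 y hy
    rw [inner_zero_right, zero_add] at this
    exact this.le

/-- A shortest obstructed line with distinct vertices and nonzero certificate vectors is, up to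
translation, a closed billiard trajectory. It fits into `T`, since otherwise it could be shrunk;
the certificate vectors are then outer normals of `T`, and the Lagrange multiplier rule makes them
proportional to the turning vectors. -/
lemma IsObstruction.exists_translate_isClosedBilliardTrajectory (hconv : Convex ℝ T)
    (hcomp : IsCompact T) (hint : (interior T).Nonempty) (hm : 2 ≤ m)
    {q u : Fin m → EuclideanSpace ℝ (Fin n)} (h : IsObstruction T q u)
    (hmin : ∀ q' u' : Fin m → EuclideanSpace ℝ (Fin n), IsObstruction T q' u' →
        closedLength q ≤ closedLength q')
    (hinj : Function.Injective q) (hu : ∀ i, u i ≠ 0) :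
    ∃ t, IsClosedBilliardTrajectory T fun i => q i + t := by
  have hTne : T.Nonempty := hint.mono interior_subset
  obtain ⟨t, ht⟩ : ∃ t, ∀ i, q i + t ∈ T := by
    by_contra hne
    obtain ⟨s, hs0, hs1, v, hv⟩ := exists_obstruction_smul hconv hcomp hTne hne
    have h1 := hmin _ _ hv
    rw [closedLength_smul s hs0.le] at h1
    nlinarith [h.closedLength_pos hint]
  have hN : ∀ i, u i ∈ outerNormalCone T (q i + t) := by
    intro i y hy
    have h1 := h.sum_inner_le (Function.update (fun l => q l + t) i y) fun l => by
      by_cases hl : l = i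
      · subst hl; simpa using hy
      · simpa [hl] using ht l
    have h2 : ∑ l, inner ℝ (u l) (Function.update (fun l => q l + t) i y l)
        = ∑ l, inner ℝ (u l) (q l + t) + inner ℝ (u i) (y - (q i + t)) := by
      rw [← sub_eq_iff_eq_add', ← Finset.sum_sub_distrib, Finset.sum_eq_single i]
      · simp [inner_sub_right]
      · intro b _ hb; simp [hb]
      · simp
    rw [h2] at h1
    simp only [inner_add_right, Finset.sum_add_distrib, h.sum_inner_const] at h1
    linarith
  have hq : ∀ j, q (finRotate m j) ≠ q j := fun j hj => finRotate_apply_ne hm j (hinj hj)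
  obtain ⟨r, hr⟩ := exists_turning_eq_smul (u := u) hq fun q' hq' =>
    hmin q' u ⟨h.ne_zero, h.sum_eq_zero, fun y hy => hq' ▸ h.sum_inner_le y hy⟩
  have hr0 : 0 < r := by
    have h1 := sum_inner_turning_self q
    simp only [hr, Pi.smul_apply, real_inner_smul_left, ← Finset.mul_sum] at h1
    refine pos_of_mul_pos_left ?_ (h.sum_inner_pos hint).le
    rw [h1]
    exact h.closedLength_pos hint
  refine ⟨t, isClosedBilliardTrajectory_of_turning hm (fun i j hij => hinj (add_right_cancel hij))
    ht (fun j => ?_) fun j => ?_⟩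
  · rw [turning_add_const, hr]
    exact smul_ne_zero hr0.ne' (hu j)
  · rw [turning_add_const, hr]
    intro y hy
    rw [Pi.smul_apply, real_inner_smul_left]
    exact mul_nonpos_of_nonneg_of_nonpos hr0.le (hN j y hy)

/-- Every obstructed polygonal line is at least as long as some closed billiard trajectory. By
induction on the number of vertices: a shortest obstructed line either is a billiard trajectory,
up to translation, or can be replaced by one with fewer vertices. -/
lemma IsObstruction.exists_billiard_le (hconv : Convex ℝ T) (hcomp : IsCompact T)
    (hint : (interior T).Nonempty) {q u : Fin m → EuclideanSpace ℝ (Fin n)}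
    (h : IsObstruction T q u) :
    ∃ (k : ℕ) (b : Fin k → EuclideanSpace ℝ (Fin n)),
      IsClosedBilliardTrajectory T b ∧ closedLength b ≤ closedLength q := by
  have hTne : T.Nonempty := hint.mono interior_subset
  induction m with
  | zero => exact absurd (Subsingleton.elim _ _) h.ne_zero
  | succ k ih =>
    rcases k with _ | k
    · exfalso
      refine h.ne_zero (funext fun i => ?_)
      obtain rfl := Fin.fin_one_eq_zero i
      simpa using h.sum_eq_zero
    obtain ⟨q₁, u₁, h₁, hmin⟩ := h.exists_minimizer
    have hle := hmin q u h
    have hdrop : ∀ u₂ : Fin (k + 2) → EuclideanSpace ℝ (Fin n), IsObstruction T q₁ u₂ →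
        (∃ j, u₂ j = 0) → ∃ (k : ℕ) (b : Fin k → EuclideanSpace ℝ (Fin n)),
          IsClosedBilliardTrajectory T b ∧ closedLength b ≤ closedLength q := by
      rintro u₂ h₂ ⟨j, hj⟩
      obtain ⟨q', u', h', hlen⟩ := h₂.exists_drop_vertex hTne hj
      obtain ⟨l, b, hb, hbl⟩ := ih h'
      have := norm_sub_le_norm_sub_add_norm_sub (q₁ (finRotate (k + 2) j)) (q₁ j)
        (q₁ ((finRotate (k + 2)).symm j))
      exact ⟨l, b, hb, by linarith⟩
    by_cases hu : ∃ j, u₁ j = 0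
    · exact hdrop u₁ h₁ hu
    push Not at hu
    by_cases hinj : Function.Injective q₁
    · obtain ⟨t, ht⟩ := h₁.exists_translate_isClosedBilliardTrajectory hconv hcomp hint
        (by omega) hmin hinj hu
      exact ⟨_, _, ht, by rwa [closedLength_add_const]⟩
    · simp only [Function.Injective, not_forall] at hinj
      obtain ⟨i, j, hq, hij⟩ := hinj
      refine hdrop _ (h₁.merge hint hq) ⟨j, ?_⟩
      simp [Pi.single_eq_of_ne (Ne.symm hij)]

end Obstructions

section MinimizingTrajectories

variable {n m : ℕ} {T : Set (EuclideanSpace ℝ (Fin n))} {p : Fin m → EuclideanSpace ℝ (Fin n)}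

/-! ### Linear relations between the turning vectors of a shortest billiard trajectory -/

namespace IsClosedBilliardTrajectory

lemma apply_finRotate_ne (hp : IsClosedBilliardTrajectory T p) (j : Fin m) :
    p (finRotate m j) ≠ p j :=
  fun h => finRotate_apply_ne hp.1 j (hp.2.1 h)

lemma mem (hcomp : IsCompact T) (hp : IsClosedBilliardTrajectory T p) (j : Fin m) : p j ∈ T :=
  hcomp.isClosed.frontier_subset (hp.2.2.1 j)

lemma turning_ne_zero (hp : IsClosedBilliardTrajectory T p) (j : Fin m) : turning p j ≠ 0 :=
  fun h => (hp.2.2.2 j).2 ((turning_eq_zero_iff hp.apply_finRotate_ne j).1 h)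

lemma turning_mem (hcomp : IsCompact T) (hp : IsClosedBilliardTrajectory T p) (j : Fin m) :
    turning p j ∈ outerNormalCone T (p j) := by
  obtain ⟨H, hH, hj, hmin⟩ := (hp.2.2.2 j).1
  exact turning_mem_outerNormalCone (hp.mem hcomp) hp.apply_finRotate_ne j hH hj hmin

end IsClosedBilliardTrajectory

lemma turning_mem_vectorSpan (q : Fin m → EuclideanSpace ℝ (Fin n)) (j : Fin m) :
    turning q j ∈ vectorSpan ℝ (Set.range q) :=
  Submodule.sub_mem _
    (Submodule.smul_mem _ _ (vsub_mem_vectorSpan ℝ (Set.mem_range_self _) (Set.mem_range_self _)))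
    (Submodule.smul_mem _ _ (vsub_mem_vectorSpan ℝ (Set.mem_range_self _) (Set.mem_range_self _)))

lemma IsLengthMinimizingTrajectory.closedLength_le (hconv : Convex ℝ T) (hcomp : IsCompact T)
    (hint : (interior T).Nonempty) (hp : IsLengthMinimizingTrajectory T p) {k : ℕ}
    {q u : Fin k → EuclideanSpace ℝ (Fin n)} (h : IsObstruction T q u) :
    closedLength p ≤ closedLength q := by
  obtain ⟨l, b, hb, hle⟩ := h.exists_billiard_le hconv hcomp hint
  exact (hp.2 l b hb).trans hle

/-- A nonnegative linear relation between the turning vectors of a shortest billiard trajectory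
that does not involve all of them is trivial: otherwise it certifies that the trajectory remains
obstructed after a vertex is left out, which makes it strictly shorter. -/
lemma IsLengthMinimizingTrajectory.relation_eq_zero (hconv : Convex ℝ T) (hcomp : IsCompact T)
    (hint : (interior T).Nonempty) (hp : IsLengthMinimizingTrajectory T p) {c : Fin m → ℝ}
    (hc : ∀ i, 0 ≤ c i) (hrel : ∑ i, c i • turning p i = 0) {j : Fin m} (hj : c j = 0) :
    c = 0 := by
  by_contra hne
  have hb := hp.1
  obtain ⟨k, rfl⟩ : ∃ k, m = k + 2 := ⟨m - 2, by have := hb.1; omega⟩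
  have hobs : IsObstruction T p fun i => c i • turning p i := by
    refine IsObstruction.of_mem_outerNormalCone (fun h0 => hne (funext fun i => ?_)) hrel
      fun i y hy => ?_
    · exact (smul_eq_zero.1 (congrFun h0 i)).resolve_right (hb.turning_ne_zero i)
    · rw [real_inner_smul_left]
      exact mul_nonpos_of_nonneg_of_nonpos (hc i) (hb.turning_mem hcomp i y hy)
  obtain ⟨q', u', h', hlen⟩ := hobs.exists_drop_vertex (hint.mono interior_subset)
    (j := j) (by simp [hj])
  have h1 := hp.closedLength_le hconv hcomp hint h'
  refine (hb.2.2.2 j).2 (mem_segment_iff_wbtw.2 (dist_add_dist_eq_iff.1 (le_antisymm ?_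
    (dist_triangle _ _ _))))
  rw [dist_eq_norm', dist_eq_norm', dist_eq_norm']
  linarith

/-- The only linear relations between the turning vectors of a shortest billiard trajectory are
the multiples of `∑ turning p i = 0`. -/
lemma IsLengthMinimizingTrajectory.relation_const (hconv : Convex ℝ T) (hcomp : IsCompact T)
    (hint : (interior T).Nonempty) (hp : IsLengthMinimizingTrajectory T p) {c : Fin m → ℝ}
    (hrel : ∑ i, c i • turning p i = 0) (i j : Fin m) : c i = c j := by
  have : Nonempty (Fin m) := ⟨i⟩
  obtain ⟨l, hl⟩ := Finite.exists_max c
  have h := hp.relation_eq_zero hconv hcomp hint (c := fun i => c l - c i) (j := l)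
    (fun i => sub_nonneg.2 (hl i))
    (by simp only [sub_smul, Finset.sum_sub_distrib, hrel, ← Finset.smul_sum, sum_turning,
      smul_zero, sub_zero]) (sub_self _)
  have hi : c l - c i = 0 := congrFun h i
  have hj : c l - c j = 0 := congrFun h j
  linarith

lemma sum_dite_ne_smul {ι E : Type*} [Fintype ι] [DecidableEq ι] [AddCommGroup E] [Module ℝ E]
    (j : ι) (g : {i // i ≠ j} → ℝ) (v : ι → E) :
    ∑ i, (if h : i ≠ j then g ⟨i, h⟩ else 0) • v i = ∑ i : {i // i ≠ j}, g i • v i := by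
  rw [← Fintype.sum_subtype_add_sum_subtype (fun i => i ≠ j), add_eq_left.2]
  · exact Finset.sum_congr rfl fun i _ => by rw [dif_pos i.2]
  · exact Finset.sum_eq_zero fun i _ => by rw [dif_neg i.2, zero_smul]

lemma IsLengthMinimizingTrajectory.linearIndependent (hconv : Convex ℝ T) (hcomp : IsCompact T)
    (hint : (interior T).Nonempty) (hp : IsLengthMinimizingTrajectory T p) (j : Fin m) :
    LinearIndependent ℝ fun i : {i // i ≠ j} => turning p i := by
  rw [Fintype.linearIndependent_iff]
  intro g hg i
  let c : Fin m → ℝ := fun i => if h : i ≠ j then g ⟨i, h⟩ else 0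
  have hc : ∑ i, c i • turning p i = 0 := (sum_dite_ne_smul j g _).trans hg
  have := hp.relation_const hconv hcomp hint hc i j
  simpa [c, i.2] using this

lemma IsLengthMinimizingTrajectory.finrank_vectorSpan (hconv : Convex ℝ T) (hcomp : IsCompact T)
    (hint : (interior T).Nonempty) (hp : IsLengthMinimizingTrajectory T p) :
    Module.finrank ℝ (vectorSpan ℝ (Set.range p)) + 1 = m := by
  have hm := hp.1.1
  refine le_antisymm ?_ ?_
  · have := finrank_vectorSpan_range_le ℝ p (n := m - 1) (by rw [Fintype.card_fin]; omega)
    omega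
  · let j : Fin m := ⟨0, by omega⟩
    have h1 := finrank_span_eq_card (hp.linearIndependent hconv hcomp hint j)
    have h2 : Submodule.span ℝ (Set.range fun i : {i // i ≠ j} => turning p i)
        ≤ vectorSpan ℝ (Set.range p) := by
      rw [Submodule.span_le]
      rintro _ ⟨i, rfl⟩
      exact turning_mem_vectorSpan p i
    have h3 := Submodule.finrank_mono h2
    rw [h1, Fintype.card_subtype_compl, Fintype.card_fin, Fintype.card_subtype_eq] at h3
    omega

lemma IsLengthMinimizingTrajectory.span_turning (hconv : Convex ℝ T) (hcomp : IsCompact T)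
    (hint : (interior T).Nonempty) (hp : IsLengthMinimizingTrajectory T p) (j : Fin m) :
    Submodule.span ℝ (Set.range fun i : {i // i ≠ j} => turning p i)
      = vectorSpan ℝ (Set.range p) := by
  refine Submodule.eq_of_le_of_finrank_eq ?_ ?_
  · rw [Submodule.span_le]
    rintro _ ⟨i, rfl⟩
    exact turning_mem_vectorSpan p i
  · have h1 := finrank_span_eq_card (hp.linearIndependent hconv hcomp hint j)
    have h3 := hp.finrank_vectorSpan hconv hcomp hint
    rw [h1, Fintype.card_subtype_compl, Fintype.card_fin, Fintype.card_subtype_eq]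
    omega

/-- At a vertex of a shortest billiard trajectory every outer normal parallel to the affine hull of
the trajectory is a multiple of the turning vector. Such a normal `w` at `p j` is a combination of
the other turning vectors, so adding `w` to a large multiple of the relation
`∑ turning p i = 0` gives another certificate that `p` is obstructed. As `p` is shortest for this
certificate too, the multiplier rule makes it proportional to the turning vectors. -/
lemma IsLengthMinimizingTrajectory.mem_span_turning (hconv : Convex ℝ T) (hcomp : IsCompact T)
    (hint : (interior T).Nonempty) (hp : IsLengthMinimizingTrajectory T p) {j : Fin m}
    {w : EuclideanSpace ℝ (Fin n)} (hw : w ∈ outerNormalCone T (p j))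
    (hwV : w ∈ vectorSpan ℝ (Set.range p)) : w ∈ Submodule.span ℝ {turning p j} := by
  have hb := hp.1
  rw [← hp.span_turning hconv hcomp hint j, Submodule.mem_span_range_iff_exists_fun] at hwV
  obtain ⟨g, hg⟩ := hwV
  let a : Fin m → ℝ := fun i => if h : i ≠ j then g ⟨i, h⟩ else 0
  have ha : ∑ i, a i • turning p i = w := (sum_dite_ne_smul j g _).trans hg
  have haj : a j = 0 := by simp [a]
  let C : ℝ := 1 + ∑ i, |a i|
  have hC : ∀ i, 0 < C - a i := fun i => by
    have h1 := Finset.single_le_sum (f := fun i => |a i|) (fun _ _ => abs_nonneg _)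
      (Finset.mem_univ i)
    have h2 := le_abs_self (a i)
    have h3 : C = 1 + ∑ i, |a i| := rfl
    linarith
  let u : Fin m → EuclideanSpace ℝ (Fin n) := 
    (fun i => (C - a i) • turning p i) + Pi.single j w
  have huj : u j = C • turning p j + w := by simp [u, haj]
  have hui : ∀ i, i ≠ j → u i = (C - a i) • turning p i := fun i hi => by simp [u, hi]
  have hobs : IsObstruction T p u := by
    refine IsObstruction.of_mem_outerNormalCone (fun h0 => ?_) ?_ fun i y hy => ?_
    · have h1 := congrFun h0 (finRotate m j)
      rw [hui _ (finRotate_apply_ne hb.1 j)] at h1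
      exact smul_ne_zero (hC _).ne' (hb.turning_ne_zero _) h1
    · simp only [u, Pi.add_apply, Finset.sum_add_distrib, sub_smul, Finset.sum_sub_distrib, ha,
        ← Finset.smul_sum, sum_turning, smul_zero]
      simp
    · have h1 := mul_nonpos_of_nonneg_of_nonpos (hC i).le (hb.turning_mem hcomp i y hy)
      by_cases hi : i = j
      · subst hi
        rw [huj, inner_add_left, real_inner_smul_left]
        rw [haj, sub_zero] at h1
        exact add_nonpos h1 (hw y hy)
      · rwa [hui i hi, real_inner_smul_left]
  obtain ⟨r, hr⟩ := exists_turning_eq_smul (u := u) hb.apply_finRotate_ne fun q' hq' =>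
    hp.closedLength_le hconv hcomp hint
      (⟨hobs.ne_zero, hobs.sum_eq_zero, fun y hy => hq' ▸ hobs.sum_inner_le y hy⟩ :
        IsObstruction T q' u)
  have hrj : turning p j = r • (C • turning p j + w) := by rw [← huj]; exact congrFun hr j
  have hr0 : r ≠ 0 := by
    rintro rfl
    exact hb.turning_ne_zero j (by rw [hrj, zero_smul])
  rw [Submodule.mem_span_singleton]
  refine ⟨r⁻¹ - C, ?_⟩
  rw [sub_smul, sub_eq_iff_eq_add', inv_smul_eq_iff₀ hr0]
  exact hrj

/-! ### The affine hull and the normal cones -/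

/-- The smallest affine section containing `p` is cut out by the affine hull of `p`, because that
affine hull competes in the definition. -/
lemma CutsOutSmallestSection.eq_affineSpan
    {V : AffineSubspace ℝ (EuclideanSpace ℝ (Fin n))} (hV : CutsOutSmallestSection T p V)
    (hT : Set.range p ⊆ T) : V = affineSpan ℝ (Set.range p) := by
  obtain ⟨h1, h2, h3⟩ := hV
  refine le_antisymm ?_ (affineSpan_le.2 fun x hx => (h1 hx).2)
  rw [← h3]
  exact affineSpan_le.2 fun x hx =>
    (h2 (affineSpan ℝ (Set.range p)) (fun y hy => ⟨hT hy, subset_affineSpan ℝ _ hy⟩) hx).2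

lemma convexDim_eq_one {S : Set (EuclideanSpace ℝ (Fin n))} {w : EuclideanSpace ℝ (Fin n)}
    (hw : w ≠ 0) (h0 : 0 ∈ S) (hwS : w ∈ S) (hS : S ⊆ Submodule.span ℝ {w}) :
    convexDim S = 1 := by
  have h1 : vectorSpan ℝ S = Submodule.span ℝ {w} := by
    refine le_antisymm (Submodule.span_le.2 ?_) ?_
    · rintro _ ⟨x, hx, y, hy, rfl⟩
      exact Submodule.sub_mem _ (hS hx) (hS hy)
    · rw [Submodule.span_singleton_le_iff_mem]
      simpa using vsub_mem_vectorSpan ℝ hwS h0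
  rw [convexDim, direction_affineSpan, h1, finrank_span_singleton hw]

lemma isSmoothBoundaryPoint_of_outerNormalCone_subset {x w : EuclideanSpace ℝ (Fin n)}
    (hx : x ∈ T) (hw : w ≠ 0) (hwN : w ∈ outerNormalCone T x)
    (hN : outerNormalCone T x ⊆ Submodule.span ℝ {w}) : IsSmoothBoundaryPoint T x := by
  refine ⟨mem_frontier_of_mem_outerNormalCone hx hwN hw, _,
    ⟨isSupportingHyperplane_of_mem_outerNormalCone hx hwN hw, rfl⟩, ?_⟩
  rintro _ ⟨⟨-, u, c, hu, rfl, hle⟩, hxc⟩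
  have hc : inner ℝ u x = c := hxc
  obtain ⟨r, rfl⟩ := Submodule.mem_span_singleton.1 (hN (show u ∈ outerNormalCone T x from
    fun y hy => by rw [inner_sub_right, hc]; linarith [hle y hy]))
  have hr : r ≠ 0 := fun h => hu (by rw [h, zero_smul])
  ext y
  simp only [Set.mem_ofPred_eq, ← hc, real_inner_smul_left, mul_right_inj' hr]

end MinimizingTrajectories

theorem theorem1p1 (n m : ℕ) (T : Set (EuclideanSpace ℝ (Fin n)))
    (hconv : Convex ℝ T) (hcomp : IsCompact T) (hint : (interior T).Nonempty)
    (p : Fin m → EuclideanSpace ℝ (Fin n)) (hp : IsLengthMinimizingTrajectory T p)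
    (V : AffineSubspace ℝ (EuclideanSpace ℝ (Fin n))) (hV : CutsOutSmallestSection T p V) :
    Module.finrank ℝ V.direction + 1 = m ∧
      convexDim (convexHull ℝ (Set.range p)) + 1 = m ∧
      m ≤ n + 1 ∧
      (∀ j, convexDim
        (outerNormalCone T (p j) ∩ (V.direction : Set (EuclideanSpace ℝ (Fin n)))) = 1) ∧
      (m = n + 1 → ∀ j, IsSmoothBoundaryPoint T (p j)) := by
  have hb := hp.1
  have hV' := hV.eq_affineSpan (Set.range_subset_iff.2 (hb.mem hcomp))
  have hdim := hp.finrank_vectorSpan hconv hcomp hint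
  have hle := (vectorSpan ℝ (Set.range p)).finrank_le
  rw [finrank_euclideanSpace_fin] at hle
  rw [hV', convexDim, affineSpan_convexHull, direction_affineSpan]
  refine ⟨hdim, hdim, by omega, fun j => ?_, fun hmn j => ?_⟩
  · exact convexDim_eq_one (hb.turning_ne_zero j)
      ⟨fun y _ => by rw [inner_zero_left], Submodule.zero_mem _⟩
      ⟨hb.turning_mem hcomp j, turning_mem_vectorSpan p j⟩
      fun w hw => hp.mem_span_turning hconv hcomp hint hw.1 hw.2
  · have htop : vectorSpan ℝ (Set.range p) = ⊤ :=
      Submodule.eq_top_of_finrank_eq (by rw [finrank_euclideanSpace_fin]; omega)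
    exact isSmoothBoundaryPoint_of_outerNormalCone_subset (hb.mem hcomp j)
      (hb.turning_ne_zero j) (hb.turning_mem hcomp j)
      fun w hw => hp.mem_span_turning hconv hcomp hint hw (by rw [htop]; trivial)
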